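/- Let $R$ be an associative unital ring (not necessarily commutative) and $n\in\mathbb N$. For $a=1,2$ let $\mathbf u^{(a)}_0=1,\mathbf u^{(a)}_1,\dots,\mathbf u^{(a)}_n\in R$ and let $\mathbf L^{\pm(a)}$ be $n\times n$ matrices over $R$ with $\mathbf L^{+(a)}$ upper triangular, $\mathbf L^{-(a)}$ lower triangular, $\mathbf L^{+(a)}_{ii}=\mathbf u^{(a)}_i$ and $\mathbf L^{-(a)}_{ii}=\mathbf u^{(a)}_{i-1}$. Put $\mathbf J=\mathbf L^{-(1)}\mathbf L^{+(2)}$ and $$\mathbf M=\begin{pmatrix}\mathbf 0&\mathbf L^{-(1)}\mathbf L^{-(2)}\\ \mathbf L^{+(1)}\mathbf L^{+(2)}&\mathbf J\end{pmatrix},$$ with rows and columns indexed by $\bar1,\dots,\bar n,1,\dots,n$ (overlined indices belong to the first block). Superscripts denote the selected rows and subscripts the selected columns of a submatrix. For a square matrix $A$ whose submatrix $A^{ij}$ (row $i$ and column $j$ deleted) is invertible, the quasi-determinant is $|A|_{ij}=a_{ij}-\sum_{k\ne j,\,l\ne i}a_{ik}((A^{ij})^{-1})_{kl}a_{lj}$.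 For a matrix $A$ with $m$ rows, the left quasi-Plücker coordinate is $q^{j_1,\dots,j_{m-1}}_{ij}(A)=|A_{i,j_1,\dots,j_{m-1}}|_{si}^{-1}\,|A_{j,j_1,\dots,j_{m-1}}|_{sj}$, computed with any row $s$ for which $|A_{i,j_1,\dots,j_{m-1}}|_{si}$ is defined and invertible; it does not depend on $s$. For a matrix $A$ with $m$ columns, the right one is $r^{i_1,\dots,i_{m-1}}_{ij}(A)=|A^{i,i_1,\dots,i_{m-1}}|_{it}\,|A^{j,i_1,\dots,i_{m-1}}|_{jt}^{-1}$, computed with any column $t$ for which $|A^{j,i_1,\dots,i_{m-1}}|_{jt}$ is defined and invertible; it does not depend on $t$. A coordinate is well defined if such an $s$ (resp. $t$) exists. Write $$q_{k,y}=q^{k+1,\dots,n}_{k\,y}\big(\mathbf M^{k,\dots,n}_{\bar1,\dots,\bar n,1,\dots,n}\big),\qquad r_{y,\bar k}=r^{k+1,\dots,n}_{y\,\bar k}\big(\mathbf M^{\bar1,\dots,\bar n,1,\dots,n}_{k,\dots,n}\big).$$ Assume that $\mathbf u^{(1)}_k\mathbf u^{(2)}_k$ is invertible for $0\le k\le n-1$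 and that $\mathbb H_k:=|\mathbf J^{k,\dots,n}_{k,\dots,n}|_{kk}$ is well defined and invertible for $1\le k\le n$. Then all coordinates $q_{k,y}$ and $r_{y,\bar k}$ are well defined. Define upper triangular matrices $\widetilde{\mathbf L}^{+(a)}$ and lower triangular matrices $\widetilde{\mathbf L}^{-(a)}$ by setting, for $1\le i\le j\le n$, $$\widetilde{\mathbf L}^{+(1)}_{ij}=q_{1,\bar1}q_{2,\bar2}\cdots q_{i-1,\overline{i-1}}\;q_{i,\bar j},\qquad \widetilde{\mathbf L}^{-(1)}_{ji}=q_{1,\bar1}q_{2,\bar2}\cdots q_{j-1,\overline{j-1}}\;q_{j,i},$$ $$\widetilde{\mathbf L}^{+(2)}_{ij}=r_{i,\bar j}\;r_{j-1,\overline{j-1}}\cdots r_{2,\bar2}\,r_{1,\bar1},\qquad \widetilde{\mathbf L}^{-(2)}_{ji}=r_{\bar j,\bar i}\;r_{i-1,\overline{i-1}}\cdots r_{2,\bar2}\,r_{1,\bar1}.$$ (1) These expressions coincide with the following quasi-determinant expressions of the Yang–Baxter map: for $1\le i\le j\le n$, with $\overrightarrow\prod$ and $\overleftarrow\prod$ ordered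 by increasing, resp. decreasing, $k$ from left to right, $$\widetilde{\mathbf L}^{+(1)}_{ij}=\Big(\overrightarrow{\prod_{k=1}^{i-1}}\mathbb H_k^{-1}\mathbf u^{(1)}_k\mathbf u^{(2)}_k\Big)\mathbb H_i^{-1}\,\big|(\mathbf L^{+(1)}\mathbf L^{+(2)})^{i,\dots,n}_{\bar j}\;\;\mathbf J^{i,\dots,n}_{i+1,\dots,n}\big|_{i\bar j},$$ $$\widetilde{\mathbf L}^{-(1)}_{ji}=\Big(\overrightarrow{\prod_{k=1}^{j-1}}\mathbb H_k^{-1}\mathbf u^{(1)}_k\mathbf u^{(2)}_k\Big)\mathbb H_j^{-1}\,\big|\mathbf J^{j,j+1,\dots,n}_{i,j+1,\dots,n}\big|_{ji},$$ $$\widetilde{\mathbf L}^{+(2)}_{ij}=\big|\mathbf J^{i,j+1,\dots,n}_{j,j+1,\dots,n}\big|_{ij}\overleftarrow{\prod_{k=1}^{j-1}}(\mathbf u^{(1)}_k\mathbf u^{(2)}_k)^{-1}\mathbb H_k,$$ $$\widetilde{\mathbf L}^{-(2)}_{ji}=\begin{vmatrix}(\mathbf L^{-(1)}\mathbf L^{-(2)})^{\bar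 j}_{i,\dots,n}\\ \mathbf J^{i+1,\dots,n}_{i,\dots,n}\end{vmatrix}_{\bar j i}\overleftarrow{\prod_{k=1}^{i-1}}(\mathbf u^{(1)}_k\mathbf u^{(2)}_k)^{-1}\mathbb H_k.$$ (2) There are $\widetilde{\mathbf u}^{(a)}_0=1,\widetilde{\mathbf u}^{(a)}_1,\dots,\widetilde{\mathbf u}^{(a)}_n\in R$ with $\widetilde{\mathbf L}^{+(a)}_{ii}=\widetilde{\mathbf u}^{(a)}_i$ and $\widetilde{\mathbf L}^{-(a)}_{ii}=\widetilde{\mathbf u}^{(a)}_{i-1}$ for $1\le i\le n$, $a=1,2$, and the zero-curvature relation holds: $$\mathbf L^{+(1)}\mathbf L^{+(2)}=\widetilde{\mathbf L}^{+(2)}\widetilde{\mathbf L}^{+(1)},\quad \mathbf L^{-(1)}\mathbf L^{+(2)}=\widetilde{\mathbf L}^{+(2)}\widetilde{\mathbf L}^{-(1)},\quad \mathbf L^{-(1)}\mathbf L^{-(2)}=\widetilde{\mathbf L}^{-(2)}\widetilde{\mathbf L}^{-(1)}.$$ -/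

import Mathlib

/-! ### Quasi-determinants over an arbitrary, not necessarily commutative, ring -/

/-- The `(i, j)`-th quasi-determinant of the square matrix `A` is well defined: the matrix `A^{ij}`,
obtained from `A` by deleting row `i` and column `j`, is invertible. -/
def QuasiDetDefined {R : Type*} [Ring R] {m : ℕ} (A : Matrix (Fin (m + 1)) (Fin (m + 1)) R)
    (i j : Fin (m + 1)) : Prop :=
  IsUnit (A.submatrix i.succAbove j.succAbove)

/-- The `(i, j)`-th quasi-determinant `a_ij - ∑ a_ik ((A^{ij})⁻¹)_kl a_lj`, with `k ≠ j`, `l ≠ i`.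
For a `1 × 1` matrix it is the entry. It is meaningful when `QuasiDetDefined A i j`. -/
noncomputable def quasiDet {R : Type*} [Ring R] {m : ℕ}
    (A : Matrix (Fin (m + 1)) (Fin (m + 1)) R) (i j : Fin (m + 1)) : R :=
  A i j - ∑ k, ∑ l, A i (j.succAbove k) *
    Ring.inverse (A.submatrix i.succAbove j.succAbove) k l * A (i.succAbove l) j

/-! ### Quasi-Plücker coordinates -/

/-- The row `s` may be used to compute the left quasi-Plücker coordinates with lower left index `i`
and upper indices `c`: the quasi-determinants at row `s` are well defined and the one to be
inverted is invertible. -/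
def LeftQPAdmissible {R : Type*} [Ring R] {m : ℕ} {κ : Type*} (A : Matrix (Fin (m + 1)) κ R)
    (c : Fin m → κ) (i : κ) (s : Fin (m + 1)) : Prop :=
  QuasiDetDefined (A.submatrix id (Fin.cons i c : Fin (m + 1) → κ)) s 0 ∧
    IsUnit (quasiDet (A.submatrix id (Fin.cons i c : Fin (m + 1) → κ)) s 0)

/-- `|A_{i, c}|_{s i}⁻¹ |A_{j, c}|_{s j}`. -/
noncomputable def leftQPAt {R : Type*} [Ring R] {m : ℕ} {κ : Type*}
    (A : Matrix (Fin (m + 1)) κ R) (c : Fin m → κ) (i j : κ) (s : Fin (m + 1)) : R :=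
  Ring.inverse (quasiDet (A.submatrix id (Fin.cons i c : Fin (m + 1) → κ)) s 0) *
    quasiDet (A.submatrix id (Fin.cons j c : Fin (m + 1) → κ)) s 0

/-- The left quasi-Plücker coordinate `q^c_{ij}(A)` is well defined. -/
def LeftQPDefined {R : Type*} [Ring R] {m : ℕ} {κ : Type*} (A : Matrix (Fin (m + 1)) κ R)
    (c : Fin m → κ) (i : κ) : Prop :=
  ∃ s, LeftQPAdmissible A c i s

open Classical in
/-- The left quasi-Plücker coordinate `q^c_{ij}(A) = |A_{i, c}|_{s i}⁻¹ |A_{j, c}|_{s j}`, for any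
admissible row `s` (see `leftQP_eq` for the independence of `s`). -/
noncomputable def leftQP {R : Type*} [Ring R] {m : ℕ} {κ : Type*}
    (A : Matrix (Fin (m + 1)) κ R) (c : Fin m → κ) (i j : κ) : R :=
  if h : LeftQPDefined A c i then leftQPAt A c i j h.choose else 0

/-- The column `t` may be used to compute the right quasi-Plücker coordinates with lower right
index `j` and upper indices `c`. -/
def RightQPAdmissible {R : Type*} [Ring R] {m : ℕ} {κ : Type*} (A : Matrix κ (Fin (m + 1)) R)
    (c : Fin m → κ) (j : κ) (t : Fin (m + 1)) : Prop :=
  QuasiDetDefined (A.submatrix (Fin.cons j c : Fin (m + 1) → κ) id) 0 t ∧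
    IsUnit (quasiDet (A.submatrix (Fin.cons j c : Fin (m + 1) → κ) id) 0 t)

/-- `|A^{i, c}|_{i t} |A^{j, c}|_{j t}⁻¹`. -/
noncomputable def rightQPAt {R : Type*} [Ring R] {m : ℕ} {κ : Type*}
    (A : Matrix κ (Fin (m + 1)) R) (c : Fin m → κ) (i j : κ) (t : Fin (m + 1)) : R :=
  quasiDet (A.submatrix (Fin.cons i c : Fin (m + 1) → κ) id) 0 t *
    Ring.inverse (quasiDet (A.submatrix (Fin.cons j c : Fin (m + 1) → κ) id) 0 t)

/-- The right quasi-Plücker coordinate `r^c_{ij}(A)` is well defined. -/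
def RightQPDefined {R : Type*} [Ring R] {m : ℕ} {κ : Type*} (A : Matrix κ (Fin (m + 1)) R)
    (c : Fin m → κ) (j : κ) : Prop :=
  ∃ t, RightQPAdmissible A c j t

open Classical in
/-- The right quasi-Plücker coordinate `r^c_{ij}(A) = |A^{i, c}|_{i t} |A^{j, c}|_{j t}⁻¹`, for any
admissible column `t` (see `rightQP_eq` for the independence of `t`). -/
noncomputable def rightQP {R : Type*} [Ring R] {m : ℕ} {κ : Type*}
    (A : Matrix κ (Fin (m + 1)) R) (c : Fin m → κ) (i j : κ) : R :=
  if h : RightQPDefined A c j then rightQPAt A c i j h.choose else 0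

/-! ### Well-definedness of the quasi-Plücker coordinates -/

/-- A quasi-determinant written with matrix-vector products. -/
theorem quasiDet_eq_sub_dotProduct {R : Type*} [Ring R] {m : ℕ}
    (A : Matrix (Fin (m + 1)) (Fin (m + 1)) R) (i j : Fin (m + 1)) :
    quasiDet A i j = A i j - dotProduct (fun k => A i (j.succAbove k))
      (Matrix.mulVec (Ring.inverse (A.submatrix i.succAbove j.succAbove))
        (fun l => A (i.succAbove l) j)) := by
  simp only [quasiDet, dotProduct, Matrix.mulVec, Finset.mul_sum, mul_assoc]

/-- A square linear system `B x = y` split along row `s` and column `0`. -/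
theorem mulVec_eq_iff_split {R : Type*} [Ring R] {m : ℕ}
    (B : Matrix (Fin (m + 1)) (Fin (m + 1)) R) (s : Fin (m + 1)) (x y : Fin (m + 1) → R) :
    Matrix.mulVec B x = y ↔
      (B s 0 * x 0 + dotProduct (fun k => B s (Fin.succAbove 0 k)) (fun k => x k.succ) = y s ∧
        (fun l => B (s.succAbove l) 0 * x 0) +
          Matrix.mulVec (B.submatrix s.succAbove (Fin.succAbove 0)) (fun k => x k.succ) =
            fun l => y (s.succAbove l)) := by
  simp only [funext_iff, Fin.forall_iff_succAbove s, Matrix.mulVec, dotProduct,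
    Fin.sum_univ_succ, Pi.add_apply, Matrix.submatrix_apply, Fin.succAbove_zero]

theorem mulVec_mul_right {R : Type*} [Ring R] {m : ℕ}
    (P : Matrix (Fin m) (Fin m) R) (v : Fin m → R) (a : R) :
    Matrix.mulVec P (fun l => v l * a) = fun l => Matrix.mulVec P v l * a := by
  funext l
  simp only [Matrix.mulVec, dotProduct, Finset.sum_mul, mul_assoc]

theorem dotProduct_mul_right {R : Type*} [Ring R] {m : ℕ}
    (w v : Fin m → R) (a : R) :
    dotProduct w (fun l => v l * a) = dotProduct w v * a := by
  simp only [dotProduct, Finset.sum_mul, mul_assoc]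

/-- The left quasi-Plücker coordinate is the first component of the solution of the linear system
with matrix `A_{i, c}` and right hand side the column `j` of `A`. -/
theorem leftQPAt_eq_of_mulVec {R : Type*} [Ring R] {m : ℕ} {κ : Type*}
    (A : Matrix (Fin (m + 1)) κ R) (c : Fin m → κ) (i j : κ) (s : Fin (m + 1))
    (hs : LeftQPAdmissible A c i s) (x : Fin (m + 1) → R)
    (hx : Matrix.mulVec (A.submatrix id (Fin.cons i c : Fin (m + 1) → κ)) x = fun r => A r j) :
    leftQPAt A c i j s = x 0 := by
  obtain ⟨hP, hd⟩ := hs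
  rw [mulVec_eq_iff_split _ s] at hx
  obtain ⟨h1, h2⟩ := hx
  unfold QuasiDetDefined at hP
  have hsub : (A.submatrix id (Fin.cons j c : Fin (m + 1) → κ)).submatrix s.succAbove
      (Fin.succAbove 0) = (A.submatrix id (Fin.cons i c : Fin (m + 1) → κ)).submatrix s.succAbove
      (Fin.succAbove 0) := by
    ext a b
    simp
  have hrow : (fun k => (A.submatrix id (Fin.cons j c : Fin (m + 1) → κ)) s (Fin.succAbove 0 k)) =
      fun k => (A.submatrix id (Fin.cons i c : Fin (m + 1) → κ)) s (Fin.succAbove 0 k) := by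
    funext k
    simp
  have key : quasiDet (A.submatrix id (Fin.cons j c : Fin (m + 1) → κ)) s 0 =
      quasiDet (A.submatrix id (Fin.cons i c : Fin (m + 1) → κ)) s 0 * x 0 := by
    rw [quasiDet_eq_sub_dotProduct, quasiDet_eq_sub_dotProduct, hsub, hrow]
    have hc : (fun l => (A.submatrix id (Fin.cons j c : Fin (m + 1) → κ)) (s.succAbove l) 0) =
        fun l => A (s.succAbove l) j := by
      funext l
      simp
    have h0 : (A.submatrix id (Fin.cons j c : Fin (m + 1) → κ)) s 0 = A s j := by simp
    rw [hc, h0, ← h2, ← h1, Matrix.mulVec_add, Matrix.mulVec_mulVec, Ring.inverse_mul_cancel _ hP,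
      Matrix.one_mulVec, mulVec_mul_right, dotProduct_add, dotProduct_mul_right, sub_mul]
    abel
  rw [leftQPAt, key, ← mul_assoc, Ring.inverse_mul_cancel _ hd, one_mul]

theorem exists_mulVec_eq {R : Type*} [Ring R] {m : ℕ} {κ : Type*}
    (A : Matrix (Fin (m + 1)) κ R) (c : Fin m → κ) (i j : κ) (s : Fin (m + 1))
    (hs : LeftQPAdmissible A c i s) :
    ∃ x : Fin (m + 1) → R,
      Matrix.mulVec (A.submatrix id (Fin.cons i c : Fin (m + 1) → κ)) x = fun r => A r j := by
  obtain ⟨hP, hd⟩ := hs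
  unfold QuasiDetDefined at hP
  set B := A.submatrix id (Fin.cons i c : Fin (m + 1) → κ) with hB
  set P := B.submatrix s.succAbove (Fin.succAbove 0) with hPd
  set w : Fin m → R := fun k => B s (Fin.succAbove 0 k) with hw
  set b : Fin m → R := fun l => B (s.succAbove l) 0 with hb
  set y : Fin m → R := fun l => A (s.succAbove l) j with hy
  have hq : quasiDet B s 0 = B s 0 - dotProduct w (Matrix.mulVec (Ring.inverse P) b) :=
    quasiDet_eq_sub_dotProduct B s 0
  set x0 : R := Ring.inverse (quasiDet B s 0) *
    (A s j - dotProduct w (Matrix.mulVec (Ring.inverse P) y)) with hx0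
  have hdx : quasiDet B s 0 * x0 =
      A s j - dotProduct w (Matrix.mulVec (Ring.inverse P) y) := by
    rw [hx0, ← mul_assoc, Ring.mul_inverse_cancel _ hd, one_mul]
  refine ⟨Fin.cons x0 (Matrix.mulVec (Ring.inverse P) (y - fun l => b l * x0)), ?_⟩
  rw [mulVec_eq_iff_split _ s]
  simp only [Fin.cons_zero, Fin.cons_succ]
  refine ⟨?_, ?_⟩
  · rw [Matrix.mulVec_sub, dotProduct_sub, mulVec_mul_right, dotProduct_mul_right]
    rw [hq, sub_mul] at hdx
    have := congrArg (· + dotProduct w (Matrix.mulVec (Ring.inverse P) y)) hdx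
    simp only [sub_add_cancel] at this
    rw [← this]
    abel
  · change (fun l => b l * x0) + Matrix.mulVec P _ = y
    rw [Matrix.mulVec_mulVec, Ring.mul_inverse_cancel _ hP, Matrix.one_mulVec]
    abel

/-- The left quasi-Plücker coordinate does not depend on the admissible row. -/
theorem leftQP_eq {R : Type*} [Ring R] {m : ℕ} {κ : Type*}
    (A : Matrix (Fin (m + 1)) κ R) (c : Fin m → κ) (i j : κ) (s : Fin (m + 1))
    (hs : LeftQPAdmissible A c i s) : leftQP A c i j = leftQPAt A c i j s := by
  have h : LeftQPDefined A c i := ⟨s, hs⟩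
  obtain ⟨x, hx⟩ := exists_mulVec_eq A c i j s hs
  rw [leftQP, dif_pos h, leftQPAt_eq_of_mulVec A c i j s hs x hx,
    leftQPAt_eq_of_mulVec A c i j _ h.choose_spec x hx]

/-- A square linear system `x B = y` split along row `0` and column `t`. -/
theorem vecMul_eq_iff_split {R : Type*} [Ring R] {m : ℕ}
    (B : Matrix (Fin (m + 1)) (Fin (m + 1)) R) (t : Fin (m + 1)) (x y : Fin (m + 1) → R) :
    Matrix.vecMul x B = y ↔
      (x 0 * B 0 t + dotProduct (fun k => x k.succ) (fun k => B (Fin.succAbove 0 k) t) = y t ∧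
        (fun l => x 0 * B 0 (t.succAbove l)) +
          Matrix.vecMul (fun k => x k.succ) (B.submatrix (Fin.succAbove 0) t.succAbove) =
            fun l => y (t.succAbove l)) := by
  simp only [funext_iff, Fin.forall_iff_succAbove t, Matrix.vecMul, dotProduct,
    Fin.sum_univ_succ, Pi.add_apply, Matrix.submatrix_apply, Fin.succAbove_zero]

/-- A quasi-determinant written with vector-matrix products. -/
theorem quasiDet_eq_sub_dotProduct' {R : Type*} [Ring R] {m : ℕ}
    (A : Matrix (Fin (m + 1)) (Fin (m + 1)) R) (i j : Fin (m + 1)) :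
    quasiDet A i j = A i j - dotProduct (Matrix.vecMul (fun k => A i (j.succAbove k))
      (Ring.inverse (A.submatrix i.succAbove j.succAbove))) (fun l => A (i.succAbove l) j) := by
  rw [quasiDet_eq_sub_dotProduct, Matrix.dotProduct_mulVec]

theorem vecMul_mul_left {R : Type*} [Ring R] {m : ℕ}
    (P : Matrix (Fin m) (Fin m) R) (v : Fin m → R) (a : R) :
    Matrix.vecMul (fun l => a * v l) P = fun l => a * Matrix.vecMul v P l := by
  funext l
  simp only [Matrix.vecMul, dotProduct, Finset.mul_sum, mul_assoc]

theorem dotProduct_mul_left {R : Type*} [Ring R] {m : ℕ}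
    (w v : Fin m → R) (a : R) :
    dotProduct (fun l => a * w l) v = a * dotProduct w v := by
  simp only [dotProduct, Finset.mul_sum, mul_assoc]

/-- The right quasi-Plücker coordinate is the first component of the solution of the linear system
`x A^{j, c} = ` (row `i` of `A`). -/
theorem rightQPAt_eq_of_vecMul {R : Type*} [Ring R] {m : ℕ} {κ : Type*}
    (A : Matrix κ (Fin (m + 1)) R) (c : Fin m → κ) (i j : κ) (t : Fin (m + 1))
    (ht : RightQPAdmissible A c j t) (x : Fin (m + 1) → R)
    (hx : Matrix.vecMul x (A.submatrix (Fin.cons j c : Fin (m + 1) → κ) id) = fun r => A i r) :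
    rightQPAt A c i j t = x 0 := by
  obtain ⟨hP, hd⟩ := ht
  rw [vecMul_eq_iff_split _ t] at hx
  obtain ⟨h1, h2⟩ := hx
  unfold QuasiDetDefined at hP
  have hsub : (A.submatrix (Fin.cons i c : Fin (m + 1) → κ) id).submatrix (Fin.succAbove 0)
      t.succAbove = (A.submatrix (Fin.cons j c : Fin (m + 1) → κ) id).submatrix (Fin.succAbove 0)
      t.succAbove := by
    ext a b
    simp
  have hcol : (fun k => (A.submatrix (Fin.cons i c : Fin (m + 1) → κ) id) (Fin.succAbove 0 k) t) =
      fun k => (A.submatrix (Fin.cons j c : Fin (m + 1) → κ) id) (Fin.succAbove 0 k) t := by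
    funext k
    simp
  have key : quasiDet (A.submatrix (Fin.cons i c : Fin (m + 1) → κ) id) 0 t =
      x 0 * quasiDet (A.submatrix (Fin.cons j c : Fin (m + 1) → κ) id) 0 t := by
    rw [quasiDet_eq_sub_dotProduct', quasiDet_eq_sub_dotProduct', hsub, hcol]
    have hc : (fun l => (A.submatrix (Fin.cons i c : Fin (m + 1) → κ) id) 0 (t.succAbove l)) =
        fun l => A i (t.succAbove l) := by
      funext l
      simp
    have h0 : (A.submatrix (Fin.cons i c : Fin (m + 1) → κ) id) 0 t = A i t := by simp
    rw [hc, h0, ← h2, ← h1, Matrix.add_vecMul, Matrix.vecMul_vecMul, Ring.mul_inverse_cancel _ hP,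
      Matrix.vecMul_one, vecMul_mul_left, add_dotProduct, dotProduct_mul_left, mul_sub]
    abel
  rw [rightQPAt, key, mul_assoc, Ring.mul_inverse_cancel _ hd, mul_one]

theorem exists_vecMul_eq {R : Type*} [Ring R] {m : ℕ} {κ : Type*}
    (A : Matrix κ (Fin (m + 1)) R) (c : Fin m → κ) (i j : κ) (t : Fin (m + 1))
    (ht : RightQPAdmissible A c j t) :
    ∃ x : Fin (m + 1) → R,
      Matrix.vecMul x (A.submatrix (Fin.cons j c : Fin (m + 1) → κ) id) = fun r => A i r := by
  obtain ⟨hP, hd⟩ := ht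
  unfold QuasiDetDefined at hP
  set B := A.submatrix (Fin.cons j c : Fin (m + 1) → κ) id with hB
  set P := B.submatrix (Fin.succAbove 0) t.succAbove with hPd
  set w : Fin m → R := fun k => B (Fin.succAbove 0 k) t with hw
  set b : Fin m → R := fun l => B 0 (t.succAbove l) with hb
  set y : Fin m → R := fun l => A i (t.succAbove l) with hy
  have hq : quasiDet B 0 t = B 0 t - dotProduct (Matrix.vecMul b (Ring.inverse P)) w :=
    quasiDet_eq_sub_dotProduct' B 0 t
  set x0 : R := (A i t - dotProduct (Matrix.vecMul y (Ring.inverse P)) w) *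
    Ring.inverse (quasiDet B 0 t) with hx0
  have hdx : x0 * quasiDet B 0 t =
      A i t - dotProduct (Matrix.vecMul y (Ring.inverse P)) w := by
    rw [hx0, mul_assoc, Ring.inverse_mul_cancel _ hd, mul_one]
  refine ⟨Fin.cons x0 (Matrix.vecMul (y - fun l => x0 * b l) (Ring.inverse P)), ?_⟩
  rw [vecMul_eq_iff_split _ t]
  simp only [Fin.cons_zero, Fin.cons_succ]
  refine ⟨?_, ?_⟩
  · rw [Matrix.sub_vecMul, sub_dotProduct, vecMul_mul_left, dotProduct_mul_left]
    rw [hq, mul_sub] at hdx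
    have := congrArg (· + dotProduct (Matrix.vecMul y (Ring.inverse P)) w) hdx
    simp only [sub_add_cancel] at this
    rw [← this]
    abel
  · change (fun l => x0 * b l) + Matrix.vecMul _ P = y
    rw [Matrix.vecMul_vecMul, Ring.inverse_mul_cancel _ hP, Matrix.vecMul_one]
    abel

/-- The right quasi-Plücker coordinate does not depend on the admissible column. -/
theorem rightQP_eq {R : Type*} [Ring R] {m : ℕ} {κ : Type*}
    (A : Matrix κ (Fin (m + 1)) R) (c : Fin m → κ) (i j : κ) (t : Fin (m + 1))
    (ht : RightQPAdmissible A c j t) : rightQP A c i j = rightQPAt A c i j t := by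
  have h : RightQPDefined A c j := ⟨t, ht⟩
  obtain ⟨x, hx⟩ := exists_vecMul_eq A c i j t ht
  rw [rightQP, dif_pos h, rightQPAt_eq_of_vecMul A c i j t ht x hx,
    rightQPAt_eq_of_vecMul A c i j _ h.choose_spec x hx]

/-! ### The zero-curvature relation -/

/-- The matrices `L⁺`, `L⁻` are upper, resp. lower triangular with diagonals
`L⁺_ii = u_i`, `L⁻_ii = u_{i-1}` for `1 ≤ i ≤ n`, where `u_0 = 1`. -/
structure IsLPair {R : Type*} [Ring R] {n : ℕ} (Lp Lm : Matrix (Fin n) (Fin n) R)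
    (u : Fin (n + 1) → R) : Prop where
  upper : ∀ i j, j < i → Lp i j = 0
  lower : ∀ i j, i < j → Lm i j = 0
  diag_upper : ∀ i, Lp i i = u i.succ
  diag_lower : ∀ i, Lm i i = u i.castSucc
  u_zero : u 0 = 1

/-- The zero-curvature relation; `Lp1` is `L^{+(1)}`, `Tp1` is `L̃^{+(1)}`, and so on. -/
def ZeroCurvature {R : Type*} [Ring R] {n : ℕ}
    (Lp1 Lm1 Lp2 Lm2 Tp1 Tm1 Tp2 Tm2 : Matrix (Fin n) (Fin n) R) : Prop :=
  Lp1 * Lp2 = Tp2 * Tp1 ∧ Lm1 * Lp2 = Tp2 * Tm1 ∧ Lm1 * Lm2 = Tm2 * Tm1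

/-! ### Indices and ordered products

Indices in `Fin n` stand for `1, …, n`. -/

/-- The list of indices `k+1, k+2, …, n`. -/
def tailIdx {n : ℕ} (k : Fin n) : Fin (n - (k.val + 1)) → Fin n :=
  fun l => ⟨k.val + 1 + l.val, by have := l.isLt; omega⟩

/-- The list of indices `i, k+1, k+2, …, n`. -/
def consTail {n : ℕ} (i k : Fin n) : Fin (n - (k.val + 1) + 1) → Fin n :=
  Fin.cons i (tailIdx k)

/-- The product `f_1 f_2 ⋯ f_{i-1}`, in this order. -/
def ascProd {R : Type*} [Ring R] {n : ℕ} (f : Fin n → R) (i : Fin n) : R :=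
  (List.ofFn fun k : Fin i.val => f (k.castLE i.isLt.le)).prod

/-- The product `f_{i-1} ⋯ f_2 f_1`, in this order. -/
def descProd {R : Type*} [Ring R] {n : ℕ} (f : Fin n → R) (i : Fin n) : R :=
  (List.ofFn fun k : Fin i.val => f (k.castLE i.isLt.le)).reverse.prod

/-! ### The map in terms of quasi-determinants -/

/-- `|J^{i, k+1, …, n}_{j, k+1, …, n}|_{ij}`. -/
noncomputable def minorQD {R : Type*} [Ring R] {n : ℕ} (J : Matrix (Fin n) (Fin n) R)
    (k i j : Fin n) : R :=
  quasiDet (J.submatrix (consTail i k) (consTail j k)) 0 0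

/-- The quasi-determinant, at the upper left entry, of the matrix whose first column is column `j`
of `X` and whose other columns are the columns `i+1, …, n` of `J`, all restricted to the rows
`i, i+1, …, n`. -/
noncomputable def colQD {R : Type*} [Ring R] {n : ℕ} (X J : Matrix (Fin n) (Fin n) R)
    (i j : Fin n) : R :=
  quasiDet (Matrix.of fun a =>
    (Fin.cons (X (consTail i i a) j) (fun l => J (consTail i i a) (tailIdx i l)) :
      Fin (n - (i.val + 1) + 1) → R)) 0 0

/-- The quasi-determinant, at the upper left entry, of the matrix whose first row is row `j`
of `X` and whose other rows are the rows `i+1, …, n` of `J`, all restricted to the columns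
`i, i+1, …, n`. -/
noncomputable def rowQD {R : Type*} [Ring R] {n : ℕ} (X J : Matrix (Fin n) (Fin n) R)
    (j i : Fin n) : R :=
  quasiDet (Matrix.of
    (Fin.cons (fun b => X j (consTail i i b)) (fun l b => J (tailIdx i l) (consTail i i b)) :
      Fin (n - (i.val + 1) + 1) → Fin (n - (i.val + 1) + 1) → R)) 0 0

/-- The factor `|J^{k, …, n}_{k, …, n}|_{kk}⁻¹ u_k^{(1)} u_k^{(2)}`. -/
noncomputable def qdFactorAsc {R : Type*} [Ring R] {n : ℕ} (J : Matrix (Fin n) (Fin n) R)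
    (u1 u2 : Fin (n + 1) → R) (k : Fin n) : R :=
  Ring.inverse (minorQD J k k k) * (u1 k.succ * u2 k.succ)

/-- The factor `(u_k^{(1)} u_k^{(2)})⁻¹ |J^{k, …, n}_{k, …, n}|_{kk}`. -/
noncomputable def qdFactorDesc {R : Type*} [Ring R] {n : ℕ} (J : Matrix (Fin n) (Fin n) R)
    (u1 u2 : Fin (n + 1) → R) (k : Fin n) : R :=
  Ring.inverse (u1 k.succ * u2 k.succ) * minorQD J k k k

/-- `L̃^{+(1)}` in terms of quasi-determinants. -/
noncomputable def qdPlus1 {R : Type*} [Ring R] {n : ℕ} (Lp1 Lm1 Lp2 : Matrix (Fin n) (Fin n) R)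
    (u1 u2 : Fin (n + 1) → R) : Matrix (Fin n) (Fin n) R :=
  Matrix.of fun i j => if i ≤ j then
    ascProd (qdFactorAsc (Lm1 * Lp2) u1 u2) i * Ring.inverse (minorQD (Lm1 * Lp2) i i i) *
      colQD (Lp1 * Lp2) (Lm1 * Lp2) i j
  else 0

/-- `L̃^{-(1)}` in terms of quasi-determinants. -/
noncomputable def qdMinus1 {R : Type*} [Ring R] {n : ℕ} (Lm1 Lp2 : Matrix (Fin n) (Fin n) R)
    (u1 u2 : Fin (n + 1) → R) : Matrix (Fin n) (Fin n) R :=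
  Matrix.of fun j i => if i ≤ j then
    ascProd (qdFactorAsc (Lm1 * Lp2) u1 u2) j * Ring.inverse (minorQD (Lm1 * Lp2) j j j) *
      minorQD (Lm1 * Lp2) j j i
  else 0

/-- `L̃^{+(2)}` in terms of quasi-determinants. -/
noncomputable def qdPlus2 {R : Type*} [Ring R] {n : ℕ} (Lm1 Lp2 : Matrix (Fin n) (Fin n) R)
    (u1 u2 : Fin (n + 1) → R) : Matrix (Fin n) (Fin n) R :=
  Matrix.of fun i j => if i ≤ j then
    minorQD (Lm1 * Lp2) j i j * descProd (qdFactorDesc (Lm1 * Lp2) u1 u2) j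
  else 0

/-- `L̃^{-(2)}` in terms of quasi-determinants. -/
noncomputable def qdMinus2 {R : Type*} [Ring R] {n : ℕ} (Lm1 Lp2 Lm2 : Matrix (Fin n) (Fin n) R)
    (u1 u2 : Fin (n + 1) → R) : Matrix (Fin n) (Fin n) R :=
  Matrix.of fun j i => if i ≤ j then
    rowQD (Lm1 * Lm2) (Lm1 * Lp2) j i * descProd (qdFactorDesc (Lm1 * Lp2) u1 u2) i
  else 0

/-! ### The map in terms of quasi-Plücker coordinates of one block matrix -/

/-- The block matrix `M`. Overlined row and column indices are `Sum.inl`, the others `Sum.inr`. -/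
def blockM {R : Type*} [Ring R] {n : ℕ} (Lp1 Lm1 Lp2 Lm2 : Matrix (Fin n) (Fin n) R) :
    Matrix (Fin n ⊕ Fin n) (Fin n ⊕ Fin n) R :=
  Matrix.fromBlocks 0 (Lm1 * Lm2) (Lp1 * Lp2) (Lm1 * Lp2)

/-- The submatrix of `M` formed by the rows `k, k+1, …, n` (not overlined) and all columns. -/
def lowerRows {R : Type*} [Ring R] {n : ℕ} (M : Matrix (Fin n ⊕ Fin n) (Fin n ⊕ Fin n) R)
    (k : Fin n) : Matrix (Fin (n - (k.val + 1) + 1)) (Fin n ⊕ Fin n) R :=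
  M.submatrix (fun a => Sum.inr (consTail k k a)) id

/-- The submatrix of `M` formed by all rows and the columns `k, k+1, …, n` (not overlined). -/
def rightCols {R : Type*} [Ring R] {n : ℕ} (M : Matrix (Fin n ⊕ Fin n) (Fin n ⊕ Fin n) R)
    (k : Fin n) : Matrix (Fin n ⊕ Fin n) (Fin (n - (k.val + 1) + 1)) R :=
  M.submatrix id (fun b => Sum.inr (consTail k k b))

/-- `q^{k+1, …, n}_{k, y}` of the rows `k, …, n` of `M`. -/
noncomputable def leftCoord {R : Type*} [Ring R] {n : ℕ}
    (M : Matrix (Fin n ⊕ Fin n) (Fin n ⊕ Fin n) R) (k : Fin n) (y : Fin n ⊕ Fin n) : R :=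
  leftQP (lowerRows M k) (fun l => Sum.inr (tailIdx k l)) (Sum.inr k) y

/-- `r^{k+1, …, n}_{y, k̄}` of the columns `k, …, n` of `M`. -/
noncomputable def rightCoord {R : Type*} [Ring R] {n : ℕ}
    (M : Matrix (Fin n ⊕ Fin n) (Fin n ⊕ Fin n) R) (k : Fin n) (y : Fin n ⊕ Fin n) : R :=
  rightQP (rightCols M k) (fun l => Sum.inr (tailIdx k l)) y (Sum.inl k)

/-- `L̃^{+(1)}` in terms of quasi-Plücker coordinates. -/
noncomputable def qpPlus1 {R : Type*} [Ring R] {n : ℕ}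
    (M : Matrix (Fin n ⊕ Fin n) (Fin n ⊕ Fin n) R) : Matrix (Fin n) (Fin n) R :=
  Matrix.of fun i j => if i ≤ j then
    ascProd (fun k => leftCoord M k (Sum.inl k)) i * leftCoord M i (Sum.inl j)
  else 0

/-- `L̃^{-(1)}` in terms of quasi-Plücker coordinates. -/
noncomputable def qpMinus1 {R : Type*} [Ring R] {n : ℕ}
    (M : Matrix (Fin n ⊕ Fin n) (Fin n ⊕ Fin n) R) : Matrix (Fin n) (Fin n) R :=
  Matrix.of fun j i => if i ≤ j then
    ascProd (fun k => leftCoord M k (Sum.inl k)) j * leftCoord M j (Sum.inr i)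
  else 0

/-- `L̃^{+(2)}` in terms of quasi-Plücker coordinates. -/
noncomputable def qpPlus2 {R : Type*} [Ring R] {n : ℕ}
    (M : Matrix (Fin n ⊕ Fin n) (Fin n ⊕ Fin n) R) : Matrix (Fin n) (Fin n) R :=
  Matrix.of fun i j => if i ≤ j then
    rightCoord M j (Sum.inr i) * descProd (fun k => rightCoord M k (Sum.inr k)) j
  else 0

/-- `L̃^{-(2)}` in terms of quasi-Plücker coordinates. -/
noncomputable def qpMinus2 {R : Type*} [Ring R] {n : ℕ}
    (M : Matrix (Fin n ⊕ Fin n) (Fin n ⊕ Fin n) R) : Matrix (Fin n) (Fin n) R :=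
  Matrix.of fun j i => if i ≤ j then
    rightCoord M i (Sum.inl j) * descProd (fun k => rightCoord M k (Sum.inr k)) i
  else 0

/-!
Eliminating the trailing columns of `J`, respectively its trailing rows, is multiplication by
unitriangular matrices `V` (upper) and `W` (lower): the quasi-determinants bordered by a matrix `X`
are the entries of `V X`, respectively of `X W`. Hence `V J W` is the diagonal matrix `D` of the
`H_k = |J^{k, …, n}_{k, …, n}|_{kk}`, and `J⁻¹ = W D⁻¹ V`. With `U = L^{+(1)} L^{+(2)}` and
`L = L^{-(1)} L^{-(2)}`, the quasi-determinant formulas say `L̃^{+(1)} = G U`, `L̃^{-(1)} = G J`,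
`L̃^{+(2)} = J F` and `L̃^{-(2)} = L F`, where `G` and `F` are `D⁻¹ V` and `W` rescaled by diagonal
matrices chosen so that `F G = J⁻¹` and the diagonals match. The zero-curvature relation then reads
`J F G U = U`, `J F G J = J` and `L F G J = L`.
-/

section QuasiDet

open scoped Matrix

variable {R : Type*} [Ring R] {m : ℕ} {A : Matrix (Fin (m + 1)) (Fin (m + 1)) R}
  {i j : Fin (m + 1)} {c : Fin m}

theorem quasiDet_eq_zero_of_column_eq (hA : QuasiDetDefined A i j)
    (h : ∀ a, A a j = A a (j.succAbove c)) : quasiDet A i j = 0 := by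
  have hcol : (fun l => A (i.succAbove l) j) =
      A.submatrix i.succAbove j.succAbove *ᵥ Pi.single c 1 := by
    ext l
    simp [h]
  rw [quasiDet_eq_sub_dotProduct, hcol, Matrix.mulVec_mulVec, Ring.inverse_mul_cancel _ hA,
    Matrix.one_mulVec, dotProduct_single_one, h, sub_self]

theorem quasiDet_eq_zero_of_row_eq (hA : QuasiDetDefined A i j)
    (h : ∀ b, A i b = A (i.succAbove c) b) : quasiDet A i j = 0 := by
  have hrow : (fun k => A i (j.succAbove k)) =
      Pi.single c 1 ᵥ* A.submatrix i.succAbove j.succAbove := by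
    ext k
    simp [h]
  rw [quasiDet_eq_sub_dotProduct', hrow, Matrix.vecMul_vecMul, Ring.mul_inverse_cancel _ hA,
    Matrix.vecMul_one, single_one_dotProduct, h, sub_self]

end QuasiDet

section Triangular

open scoped Finset

variable {R ι α : Type*} [Ring R] [Fintype ι] [LinearOrder α] {b : ι → α}

theorem mul_apply_self_of_blockTriangular {M N : Matrix ι ι R} (hb : b.Injective)
    (hM : M.BlockTriangular b) (hN : N.BlockTriangular b) (i : ι) :
    (M * N) i i = M i i * N i i := by
  rw [Matrix.mul_apply, Fintype.sum_eq_single i]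
  intro l hl
  rcases lt_or_gt_of_ne (hb.ne hl) with h | h
  · rw [hM h, zero_mul]
  · rw [hN h, mul_zero]

variable [DecidableEq ι]

theorem pow_apply_eq_zero_of_strictlyTriangular {N : Matrix ι ι R}
    (hN : ∀ i j, b j ≤ b i → N i j = 0) (p : ℕ) (i j : ι) (hp : #{l | b l < b j} < p) :
    (N ^ p) i j = 0 := by
  induction p generalizing j with
  | zero => exact absurd hp (Nat.not_lt_zero _)
  | succ p ih =>
    rw [pow_succ, Matrix.mul_apply]
    refine Finset.sum_eq_zero fun l _ => ?_
    rcases le_or_gt (b j) (b l) with h | h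
    · rw [hN l j h, mul_zero]
    · have hlt : #{x | b x < b l} < #{x | b x < b j} := by
        refine Finset.card_lt_card (Finset.ssubset_iff_of_subset ?_ |>.2 ⟨l, ?_, ?_⟩)
        · exact Finset.monotone_filter_right _ fun x _ hx => hx.trans h
        · simpa using h
        · simp
      rw [ih l (by omega), zero_mul]

theorem isUnit_of_unitriangular {V : Matrix ι ι R}
    (hV : ∀ i j, b j ≤ b i → V i j = (1 : Matrix ι ι R) i j) : IsUnit V := by
  have hN : ∀ i j, b j ≤ b i → (1 - V) i j = 0 := fun i j h => by
    rw [Matrix.sub_apply, hV i j h, sub_self]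
  have hnil : IsNilpotent (1 - V) := ⟨Fintype.card ι + 1, by
    ext i j
    exact pow_apply_eq_zero_of_strictlyTriangular hN _ i j
      (Nat.lt_succ_of_le (Finset.card_le_univ _))⟩
  simpa using hnil.isUnit_one_sub

end Triangular

theorem two_sided_inverse_of_mul_mul_eq {S : Type*} [Monoid S] {v a w d d' : S} (hv : IsUnit v)
    (hw : IsUnit w) (hd : d * d' = 1) (hd' : d' * d = 1) (h : v * a * w = d) :
    a * (w * d' * v) = 1 ∧ w * d' * v * a = 1 := by
  obtain ⟨v, rfl⟩ := hv
  obtain ⟨w, rfl⟩ := hw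
  obtain rfl : a = ↑v⁻¹ * d * ↑w⁻¹ := by simp [← h, mul_assoc]
  constructor
  · simp [mul_assoc, ← mul_assoc d, hd]
  · simp [mul_assoc, ← mul_assoc d', hd']

section OrderedProducts

variable {R : Type*} [Ring R] {n : ℕ}

theorem ascProd_zero (f : Fin n → R) (h : 0 < n) : ascProd f ⟨0, h⟩ = 1 := by
  simp [ascProd]

theorem descProd_zero (f : Fin n → R) (h : 0 < n) : descProd f ⟨0, h⟩ = 1 := by
  simp [descProd]

theorem ascProd_succ (f : Fin n → R) (i : ℕ) (h : i + 1 < n) :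
    ascProd f ⟨i + 1, h⟩ = ascProd f ⟨i, by omega⟩ * f ⟨i, by omega⟩ := by
  simp only [ascProd, List.ofFn_succ', List.concat_eq_append, List.prod_append,
    List.prod_singleton]
  rfl

theorem descProd_succ (f : Fin n → R) (i : ℕ) (h : i + 1 < n) :
    descProd f ⟨i + 1, h⟩ = f ⟨i, by omega⟩ * descProd f ⟨i, by omega⟩ := by
  simp only [descProd, List.ofFn_succ', List.concat_eq_append, List.reverse_append,
    List.prod_append, List.reverse_singleton, List.prod_singleton]
  rfl

theorem descProd_mul_ascProd {f g : Fin n → R} (hgf : ∀ k : Fin n, k.val + 1 < n → g k * f k = 1)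
    (i : Fin n) : descProd g i * ascProd f i = 1 := by
  obtain ⟨i, hi⟩ := i
  induction i with
  | zero => rw [ascProd_zero, descProd_zero, one_mul]
  | succ i ih =>
    rw [ascProd_succ, descProd_succ, mul_assoc, ← mul_assoc (descProd g _), ih, one_mul, hgf _ hi]

theorem mul_descProd_castSucc (H : Fin n → R) {w : Fin (n + 1) → R} (hw : w 0 = 1) (j : Fin n) :
    w j.castSucc * descProd (fun k => H k * w k.castSucc) j =
      descProd (fun k => w k.succ * H k) j := by
  obtain ⟨j, hj⟩ := j
  induction j with
  | zero => rw [descProd_zero, descProd_zero, mul_one]; exact hw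
  | succ j ih => rw [descProd_succ, descProd_succ, ← ih, mul_assoc, mul_assoc]; rfl

end OrderedProducts

section Elimination

open scoped Matrix

variable {R : Type*} [Ring R] {n : ℕ}

theorem lt_tailIdx (k : Fin n) (a : Fin (n - (k.val + 1))) : k < tailIdx k a := by
  rw [Fin.lt_def, tailIdx]
  dsimp only
  omega

theorem exists_tailIdx_eq {k j : Fin n} (h : k < j) : ∃ a, tailIdx k a = j :=
  ⟨⟨j.val - (k.val + 1), by omega⟩, by ext; simp only [tailIdx]; omega⟩

theorem minorQD_eq_zero_of_lt_right {J : Matrix (Fin n) (Fin n) R} {k : Fin n}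
    (hk : IsUnit (J.submatrix (tailIdx k) (tailIdx k))) (i : Fin n) {j : Fin n} (h : k < j) :
    minorQD J k i j = 0 := by
  obtain ⟨c, rfl⟩ := exists_tailIdx_eq h
  exact quasiDet_eq_zero_of_column_eq (c := c) hk fun _ => rfl

theorem minorQD_eq_zero_of_lt_left {J : Matrix (Fin n) (Fin n) R} {k : Fin n}
    (hk : IsUnit (J.submatrix (tailIdx k) (tailIdx k))) {i : Fin n} (j : Fin n) (h : k < i) :
    minorQD J k i j = 0 := by
  obtain ⟨c, rfl⟩ := exists_tailIdx_eq h
  exact quasiDet_eq_zero_of_row_eq (c := c) hk fun _ => rfl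

theorem colQD_eq_sub_dotProduct (X J : Matrix (Fin n) (Fin n) R) (i j : Fin n) :
    colQD X J i j = X i j - ((fun a => J i (tailIdx i a)) ᵥ*
      Ring.inverse (J.submatrix (tailIdx i) (tailIdx i))) ⬝ᵥ fun a => X (tailIdx i a) j :=
  quasiDet_eq_sub_dotProduct' _ 0 0

theorem rowQD_eq_sub_dotProduct (Y J : Matrix (Fin n) (Fin n) R) (j i : Fin n) :
    rowQD Y J j i = Y j i - (fun a => Y j (tailIdx i a)) ⬝ᵥ
      (Ring.inverse (J.submatrix (tailIdx i) (tailIdx i)) *ᵥ fun a => J (tailIdx i a) i) :=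
  quasiDet_eq_sub_dotProduct _ 0 0

theorem colQD_self (J : Matrix (Fin n) (Fin n) R) (k j : Fin n) :
    colQD J J k j = minorQD J k k j := by
  rfl

theorem rowQD_self (J : Matrix (Fin n) (Fin n) R) (i k : Fin n) :
    rowQD J J i k = minorQD J k i k := by
  rfl

theorem colQD_eq_apply {X : Matrix (Fin n) (Fin n) R} (J : Matrix (Fin n) (Fin n) R) {i j : Fin n}
    (hX : ∀ a, i < a → X a j = 0) : colQD X J i j = X i j := by
  have hcol : (fun a => X (tailIdx i a) j) = 0 := funext fun a => hX _ (lt_tailIdx i a)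
  rw [colQD_eq_sub_dotProduct, hcol, dotProduct_zero, sub_zero]

theorem rowQD_eq_apply {Y : Matrix (Fin n) (Fin n) R} (J : Matrix (Fin n) (Fin n) R) {j i : Fin n}
    (hY : ∀ a, i < a → Y j a = 0) : rowQD Y J j i = Y j i := by
  have hrow : (fun a => Y j (tailIdx i a)) = 0 := funext fun a => hY _ (lt_tailIdx i a)
  rw [rowQD_eq_sub_dotProduct, hrow, zero_dotProduct, sub_zero]

/-- The upper unitriangular matrix `V` of the row elimination making `V * J` lower triangular.
Its entries are the quasi-determinants bordered by the columns of the identity matrix. -/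
noncomputable def upperElim (J : Matrix (Fin n) (Fin n) R) : Matrix (Fin n) (Fin n) R :=
  Matrix.of (colQD 1 J)

/-- The lower unitriangular matrix `W` of the column elimination making `J * W` upper triangular.
Its entries are the quasi-determinants bordered by the rows of the identity matrix. -/
noncomputable def lowerElim (J : Matrix (Fin n) (Fin n) R) : Matrix (Fin n) (Fin n) R :=
  Matrix.of (rowQD 1 J)

theorem colQD_mul_apply (X Y J : Matrix (Fin n) (Fin n) R) (i j : Fin n) :
    colQD (X * Y) J i j = ∑ a, colQD X J i a * Y a j := by
  simp only [colQD_eq_sub_dotProduct, sub_mul, Finset.sum_sub_distrib, ← Matrix.mul_apply]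
  congr 1
  exact congrFun (Matrix.vecMul_vecMul _ (X.submatrix (tailIdx i) id) Y).symm j

theorem rowQD_mul_apply (X Y J : Matrix (Fin n) (Fin n) R) (j i : Fin n) :
    rowQD (X * Y) J j i = ∑ a, X j a * rowQD Y J a i := by
  simp only [rowQD_eq_sub_dotProduct, mul_sub, Finset.sum_sub_distrib, ← Matrix.mul_apply]
  congr 1
  exact congrFun (Matrix.mulVec_mulVec _ X (Y.submatrix id (tailIdx i))).symm j

theorem upperElim_mul (J X : Matrix (Fin n) (Fin n) R) :
    upperElim J * X = Matrix.of (colQD X J) := by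
  ext i j
  rw [Matrix.of_apply, ← one_mul X, colQD_mul_apply, one_mul, Matrix.mul_apply]
  rfl

theorem mul_lowerElim (J Y : Matrix (Fin n) (Fin n) R) :
    Y * lowerElim J = Matrix.of (rowQD Y J) := by
  ext j i
  rw [Matrix.of_apply, ← mul_one Y, rowQD_mul_apply, mul_one, Matrix.mul_apply]
  rfl

theorem upperElim_apply_of_le (J : Matrix (Fin n) (Fin n) R) {i j : Fin n} (h : j ≤ i) :
    upperElim J i j = (1 : Matrix (Fin n) (Fin n) R) i j :=
  colQD_eq_apply J fun _ ha => Matrix.one_apply_ne (h.trans_lt ha).ne'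

theorem lowerElim_apply_of_le (J : Matrix (Fin n) (Fin n) R) {i j : Fin n} (h : i ≤ j) :
    lowerElim J i j = (1 : Matrix (Fin n) (Fin n) R) i j :=
  rowQD_eq_apply J fun _ ha => Matrix.one_apply_ne (h.trans_lt ha).ne

theorem blockTriangular_upperElim (J : Matrix (Fin n) (Fin n) R) :
    (upperElim J).BlockTriangular id := fun _ _ h =>
  (upperElim_apply_of_le J h.le).trans (Matrix.one_apply_ne h.ne')

theorem blockTriangular_lowerElim (J : Matrix (Fin n) (Fin n) R) :
    (lowerElim J).BlockTriangular OrderDual.toDual := fun _ _ h =>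
  (lowerElim_apply_of_le J (OrderDual.toDual_lt_toDual.1 h).le).trans
    (Matrix.one_apply_ne (OrderDual.toDual_lt_toDual.1 h).ne)

theorem isUnit_upperElim (J : Matrix (Fin n) (Fin n) R) : IsUnit (upperElim J) :=
  isUnit_of_unitriangular (b := id) fun _ _ h => upperElim_apply_of_le J h

theorem isUnit_lowerElim (J : Matrix (Fin n) (Fin n) R) : IsUnit (lowerElim J) :=
  isUnit_of_unitriangular (b := OrderDual.toDual) fun _ _ h => lowerElim_apply_of_le J h

theorem blockTriangular_upperElim_mul_self {J : Matrix (Fin n) (Fin n) R}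
    (hJ : ∀ k, IsUnit (J.submatrix (tailIdx k) (tailIdx k))) :
    (upperElim J * J).BlockTriangular OrderDual.toDual := fun i j h => by
  rw [upperElim_mul, Matrix.of_apply, colQD_self]
  exact minorQD_eq_zero_of_lt_right (hJ i) i h

theorem blockTriangular_self_mul_lowerElim {J : Matrix (Fin n) (Fin n) R}
    (hJ : ∀ k, IsUnit (J.submatrix (tailIdx k) (tailIdx k))) :
    (J * lowerElim J).BlockTriangular id := fun i j h => by
  rw [mul_lowerElim, Matrix.of_apply, rowQD_self]
  exact minorQD_eq_zero_of_lt_left (hJ j) j h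

theorem upperElim_mul_mul_lowerElim {J : Matrix (Fin n) (Fin n) R}
    (hJ : ∀ k, IsUnit (J.submatrix (tailIdx k) (tailIdx k))) :
    upperElim J * J * lowerElim J = Matrix.diagonal fun k => minorQD J k k k := by
  have hVJ := blockTriangular_upperElim_mul_self hJ
  have hW := blockTriangular_lowerElim J
  ext i j
  rcases lt_trichotomy i j with h | rfl | h
  · rw [Matrix.diagonal_apply_ne _ h.ne]
    exact hVJ.mul hW (OrderDual.toDual_lt_toDual.2 h)
  · rw [mul_apply_self_of_blockTriangular OrderDual.toDual.injective hVJ hW, upperElim_mul,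
      Matrix.of_apply, colQD_self, lowerElim_apply_of_le J le_rfl, Matrix.one_apply_eq, mul_one,
      Matrix.diagonal_apply_eq]
  · rw [Matrix.diagonal_apply_ne _ h.ne', mul_assoc]
    exact (blockTriangular_upperElim J).mul (blockTriangular_self_mul_lowerElim hJ) h

theorem inverse_eq_lowerElim_mul_upperElim {J : Matrix (Fin n) (Fin n) R}
    (hJ : ∀ k, IsUnit (J.submatrix (tailIdx k) (tailIdx k)))
    (hH : ∀ k, IsUnit (minorQD J k k k)) :
    J * (lowerElim J * (Matrix.diagonal fun k => Ring.inverse (minorQD J k k k)) *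
        upperElim J) = 1 ∧
      lowerElim J * (Matrix.diagonal fun k => Ring.inverse (minorQD J k k k)) *
        upperElim J * J = 1 := by
  refine two_sided_inverse_of_mul_mul_eq (isUnit_upperElim J) (isUnit_lowerElim J) ?_ ?_
    (upperElim_mul_mul_lowerElim hJ)
  · simp only [Matrix.diagonal_mul_diagonal, Ring.mul_inverse_cancel _ (hH _), Matrix.diagonal_one]
  · simp only [Matrix.diagonal_mul_diagonal, Ring.inverse_mul_cancel _ (hH _), Matrix.diagonal_one]

end Elimination

section Coordinates

variable {R : Type*} [Ring R] {n : ℕ} {M : Matrix (Fin n ⊕ Fin n) (Fin n ⊕ Fin n) R} {k : Fin n}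

theorem leftQPDefined_lowerRows (hk : IsUnit (M.toBlocks₂₂.submatrix (tailIdx k) (tailIdx k)))
    (hH : IsUnit (minorQD M.toBlocks₂₂ k k k)) :
    LeftQPDefined (lowerRows M k) (fun l => Sum.inr (tailIdx k l)) (Sum.inr k) :=
  ⟨0, hk, hH⟩

theorem rightQPDefined_rightCols (hk : IsUnit (M.toBlocks₂₂.submatrix (tailIdx k) (tailIdx k)))
    (hL : IsUnit (rowQD M.toBlocks₁₂ M.toBlocks₂₂ k k)) :
    RightQPDefined (rightCols M k) (fun l => Sum.inr (tailIdx k l)) (Sum.inl k) :=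
  ⟨0, hk, hL⟩

theorem leftCoord_inl (hk : IsUnit (M.toBlocks₂₂.submatrix (tailIdx k) (tailIdx k)))
    (hH : IsUnit (minorQD M.toBlocks₂₂ k k k)) (j : Fin n) :
    leftCoord M k (Sum.inl j) =
      Ring.inverse (minorQD M.toBlocks₂₂ k k k) * colQD M.toBlocks₂₁ M.toBlocks₂₂ k j :=
  leftQP_eq _ _ _ _ 0 ⟨hk, hH⟩

theorem leftCoord_inr (hk : IsUnit (M.toBlocks₂₂.submatrix (tailIdx k) (tailIdx k)))
    (hH : IsUnit (minorQD M.toBlocks₂₂ k k k)) (j : Fin n) :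
    leftCoord M k (Sum.inr j) =
      Ring.inverse (minorQD M.toBlocks₂₂ k k k) * minorQD M.toBlocks₂₂ k k j :=
  leftQP_eq _ _ _ _ 0 ⟨hk, hH⟩

theorem rightCoord_inl (hk : IsUnit (M.toBlocks₂₂.submatrix (tailIdx k) (tailIdx k)))
    (hL : IsUnit (rowQD M.toBlocks₁₂ M.toBlocks₂₂ k k)) (j : Fin n) :
    rightCoord M k (Sum.inl j) = rowQD M.toBlocks₁₂ M.toBlocks₂₂ j k *
      Ring.inverse (rowQD M.toBlocks₁₂ M.toBlocks₂₂ k k) :=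
  rightQP_eq _ _ _ _ 0 ⟨hk, hL⟩

theorem rightCoord_inr (hk : IsUnit (M.toBlocks₂₂.submatrix (tailIdx k) (tailIdx k)))
    (hL : IsUnit (rowQD M.toBlocks₁₂ M.toBlocks₂₂ k k)) (i : Fin n) :
    rightCoord M k (Sum.inr i) = minorQD M.toBlocks₂₂ k i k *
      Ring.inverse (rowQD M.toBlocks₁₂ M.toBlocks₂₂ k k) :=
  rightQP_eq _ _ _ _ 0 ⟨hk, hL⟩

end Coordinates

section LPair

variable {R : Type*} [Ring R] {n : ℕ}

theorem IsLPair.mul {Lp1 Lm1 Lp2 Lm2 : Matrix (Fin n) (Fin n) R} {u1 u2 : Fin (n + 1) → R}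
    (h1 : IsLPair Lp1 Lm1 u1) (h2 : IsLPair Lp2 Lm2 u2) :
    IsLPair (Lp1 * Lp2) (Lm1 * Lm2) (u1 * u2) := by
  have hp1 : Lp1.BlockTriangular id := h1.upper
  have hp2 : Lp2.BlockTriangular id := h2.upper
  have hm1 : Lm1.BlockTriangular OrderDual.toDual := h1.lower
  have hm2 : Lm2.BlockTriangular OrderDual.toDual := h2.lower
  exact {
    upper := hp1.mul hp2
    lower := hm1.mul hm2
    diag_upper := fun i => by
      rw [mul_apply_self_of_blockTriangular Function.injective_id hp1 hp2, h1.diag_upper,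
        h2.diag_upper, Pi.mul_apply]
    diag_lower := fun i => by
      rw [mul_apply_self_of_blockTriangular OrderDual.toDual.injective hm1 hm2, h1.diag_lower,
        h2.diag_lower, Pi.mul_apply]
    u_zero := by rw [Pi.mul_apply, h1.u_zero, h2.u_zero, one_mul] }

theorem exists_isLPair {Lp Lm : Matrix (Fin n) (Fin n) R} (hp : ∀ i j, j < i → Lp i j = 0)
    (hm : ∀ i j, i < j → Lm i j = 0) (hzero : ∀ h : 0 < n, Lm ⟨0, h⟩ ⟨0, h⟩ = 1)
    (hsucc : ∀ i (h : i + 1 < n),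
      Lm ⟨i + 1, h⟩ ⟨i + 1, h⟩ = Lp ⟨i, by omega⟩ ⟨i, by omega⟩) :
    ∃ v, IsLPair Lp Lm v := by
  refine ⟨Fin.cons 1 fun i => Lp i i, hp, hm, fun _ => rfl, ?_, rfl⟩
  rintro ⟨_ | i, hi⟩
  · exact hzero hi
  · exact hsucc i hi

variable {U L : Matrix (Fin n) (Fin n) R} {u : Fin (n + 1) → R}

theorem IsLPair.colQD_self (h : IsLPair U L u) (J : Matrix (Fin n) (Fin n) R) (i : Fin n) :
    colQD U J i i = u i.succ := by
  rw [colQD_eq_apply J fun a ha => h.upper a i ha, h.diag_upper]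

theorem IsLPair.colQD_eq_zero (h : IsLPair U L u) (J : Matrix (Fin n) (Fin n) R) {i j : Fin n}
    (hij : j < i) : colQD U J i j = 0 := by
  rw [colQD_eq_apply J fun a ha => h.upper a j (hij.trans ha), h.upper i j hij]

theorem IsLPair.rowQD_self (h : IsLPair U L u) (J : Matrix (Fin n) (Fin n) R) (i : Fin n) :
    rowQD L J i i = u i.castSucc := by
  rw [rowQD_eq_apply J fun a ha => h.lower i a ha, h.diag_lower]

theorem IsLPair.rowQD_eq_zero (h : IsLPair U L u) (J : Matrix (Fin n) (Fin n) R) {j i : Fin n}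
    (hji : j < i) : rowQD L J j i = 0 := by
  rw [rowQD_eq_apply J fun a ha => h.lower j a (hji.trans ha), h.lower j i hji]

end LPair

section Gauge

variable {R : Type*} [Ring R] {n : ℕ}

/-- The common left factor of `L̃^{±(1)}`: `L̃^{+(1)} = leftGauge * (L^{+(1)} L^{+(2)})` and
`L̃^{-(1)} = leftGauge * J`. -/
noncomputable def leftGauge (J : Matrix (Fin n) (Fin n) R) (u1 u2 : Fin (n + 1) → R) :
    Matrix (Fin n) (Fin n) R :=
  Matrix.diagonal (ascProd (qdFactorAsc J u1 u2)) *
    (Matrix.diagonal fun k => Ring.inverse (minorQD J k k k)) * upperElim J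

/-- The common right factor of `L̃^{±(2)}`: `L̃^{+(2)} = J * rightGauge` and
`L̃^{-(2)} = (L^{-(1)} L^{-(2)}) * rightGauge`. -/
noncomputable def rightGauge (J : Matrix (Fin n) (Fin n) R) (u1 u2 : Fin (n + 1) → R) :
    Matrix (Fin n) (Fin n) R :=
  lowerElim J * Matrix.diagonal (descProd (qdFactorDesc J u1 u2))

theorem leftGauge_mul_apply (J X : Matrix (Fin n) (Fin n) R) (u1 u2 : Fin (n + 1) → R)
    (i j : Fin n) : (leftGauge J u1 u2 * X) i j =
      ascProd (qdFactorAsc J u1 u2) i * Ring.inverse (minorQD J i i i) * colQD X J i j := by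
  rw [leftGauge, mul_assoc _ (upperElim J), upperElim_mul, Matrix.diagonal_mul_diagonal,
    Matrix.diagonal_mul, Matrix.of_apply]

theorem mul_rightGauge_apply (J Y : Matrix (Fin n) (Fin n) R) (u1 u2 : Fin (n + 1) → R)
    (j i : Fin n) :
    (Y * rightGauge J u1 u2) j i = rowQD Y J j i * descProd (qdFactorDesc J u1 u2) i := by
  rw [rightGauge, ← mul_assoc, mul_lowerElim, Matrix.mul_diagonal, Matrix.of_apply]

theorem qdFactorDesc_mul_qdFactorAsc {J : Matrix (Fin n) (Fin n) R} {u1 u2 : Fin (n + 1) → R}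
    {k : Fin n} (hu : IsUnit (u1 k.succ * u2 k.succ)) (hH : IsUnit (minorQD J k k k)) :
    qdFactorDesc J u1 u2 k * qdFactorAsc J u1 u2 k = 1 := by
  rw [qdFactorAsc, qdFactorDesc, mul_assoc, Ring.mul_inverse_cancel_left _ _ hH,
    Ring.inverse_mul_cancel _ hu]

theorem rightGauge_mul_leftGauge {J : Matrix (Fin n) (Fin n) R} {u1 u2 : Fin (n + 1) → R}
    (hu : ∀ k : Fin n, IsUnit (u1 k.castSucc * u2 k.castSucc))
    (hH : ∀ k, IsUnit (minorQD J k k k)) :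
    rightGauge J u1 u2 * leftGauge J u1 u2 =
      lowerElim J * (Matrix.diagonal fun k => Ring.inverse (minorQD J k k k)) * upperElim J := by
  have hprod : Matrix.diagonal (descProd (qdFactorDesc J u1 u2)) *
      Matrix.diagonal (ascProd (qdFactorAsc J u1 u2)) = 1 := by
    have hfactor (k : Fin n) (hk : k.val + 1 < n) :
        qdFactorDesc J u1 u2 k * qdFactorAsc J u1 u2 k = 1 :=
      qdFactorDesc_mul_qdFactorAsc (hu ⟨k + 1, hk⟩) (hH k)
    simp only [Matrix.diagonal_mul_diagonal, descProd_mul_ascProd hfactor, Matrix.diagonal_one]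
  rw [rightGauge, leftGauge, mul_assoc, ← mul_assoc (Matrix.diagonal _),
    ← mul_assoc (Matrix.diagonal _), hprod, one_mul, mul_assoc]

variable {Lp1 Lm1 Lp2 Lm2 : Matrix (Fin n) (Fin n) R} {u1 u2 : Fin (n + 1) → R}

theorem qdPlus1_eq_leftGauge_mul (h : IsLPair (Lp1 * Lp2) (Lm1 * Lm2) (u1 * u2)) :
    qdPlus1 Lp1 Lm1 Lp2 u1 u2 = leftGauge (Lm1 * Lp2) u1 u2 * (Lp1 * Lp2) := by
  ext i j
  rw [leftGauge_mul_apply, qdPlus1, Matrix.of_apply, ite_eq_left_iff, not_le]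
  intro hij
  rw [h.colQD_eq_zero _ hij, mul_zero]

theorem qdMinus1_eq_leftGauge_mul
    (hJ : ∀ k, IsUnit ((Lm1 * Lp2).submatrix (tailIdx k) (tailIdx k))) :
    qdMinus1 Lm1 Lp2 u1 u2 = leftGauge (Lm1 * Lp2) u1 u2 * (Lm1 * Lp2) := by
  ext j i
  rw [leftGauge_mul_apply, qdMinus1, Matrix.of_apply, colQD_self, ite_eq_left_iff, not_le]
  intro hji
  rw [minorQD_eq_zero_of_lt_right (hJ j) j hji, mul_zero]

theorem qdPlus2_eq_mul_rightGauge
    (hJ : ∀ k, IsUnit ((Lm1 * Lp2).submatrix (tailIdx k) (tailIdx k))) :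
    qdPlus2 Lm1 Lp2 u1 u2 = Lm1 * Lp2 * rightGauge (Lm1 * Lp2) u1 u2 := by
  ext i j
  rw [mul_rightGauge_apply, qdPlus2, Matrix.of_apply, rowQD_self, ite_eq_left_iff, not_le]
  intro hij
  rw [minorQD_eq_zero_of_lt_left (hJ j) j hij, zero_mul]

theorem qdMinus2_eq_mul_rightGauge (h : IsLPair (Lp1 * Lp2) (Lm1 * Lm2) (u1 * u2)) :
    qdMinus2 Lm1 Lp2 Lm2 u1 u2 = Lm1 * Lm2 * rightGauge (Lm1 * Lp2) u1 u2 := by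
  ext j i
  rw [mul_rightGauge_apply, qdMinus2, Matrix.of_apply, ite_eq_left_iff, not_le]
  intro hji
  rw [h.rowQD_eq_zero _ hji, zero_mul]

theorem zeroCurvature_qd (h : IsLPair (Lp1 * Lp2) (Lm1 * Lm2) (u1 * u2))
    (hu : ∀ k : Fin n, IsUnit (u1 k.castSucc * u2 k.castSucc))
    (hJ : ∀ k, IsUnit ((Lm1 * Lp2).submatrix (tailIdx k) (tailIdx k)))
    (hH : ∀ k, IsUnit (minorQD (Lm1 * Lp2) k k k)) :
    ZeroCurvature Lp1 Lm1 Lp2 Lm2 (qdPlus1 Lp1 Lm1 Lp2 u1 u2) (qdMinus1 Lm1 Lp2 u1 u2)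
      (qdPlus2 Lm1 Lp2 u1 u2) (qdMinus2 Lm1 Lp2 Lm2 u1 u2) := by
  obtain ⟨hright, hleft⟩ := inverse_eq_lowerElim_mul_upperElim hJ hH
  rw [← rightGauge_mul_leftGauge hu hH] at hright hleft
  rw [ZeroCurvature, qdPlus1_eq_leftGauge_mul h, qdMinus1_eq_leftGauge_mul hJ,
    qdPlus2_eq_mul_rightGauge hJ, qdMinus2_eq_mul_rightGauge h]
  generalize Lm1 * Lp2 = J at *
  have cancel (X Y : Matrix (Fin n) (Fin n) R) :
      X * rightGauge J u1 u2 * (leftGauge J u1 u2 * Y) =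
        X * (rightGauge J u1 u2 * leftGauge J u1 u2) * Y := by
    simp only [mul_assoc]
  refine ⟨?_, ?_, ?_⟩
  · rw [cancel, hright, one_mul]
  · rw [cancel, hright, one_mul]
  · rw [cancel, mul_assoc, hleft, mul_one]

theorem qdPlus1_apply_self (h : IsLPair (Lp1 * Lp2) (Lm1 * Lm2) (u1 * u2)) (i : Fin n) :
    qdPlus1 Lp1 Lm1 Lp2 u1 u2 i i =
      ascProd (qdFactorAsc (Lm1 * Lp2) u1 u2) i * qdFactorAsc (Lm1 * Lp2) u1 u2 i := by
  rw [qdPlus1, Matrix.of_apply, if_pos le_rfl, h.colQD_self, mul_assoc]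
  rfl

theorem qdMinus1_apply_self {i : Fin n} (hH : IsUnit (minorQD (Lm1 * Lp2) i i i)) :
    qdMinus1 Lm1 Lp2 u1 u2 i i = ascProd (qdFactorAsc (Lm1 * Lp2) u1 u2) i := by
  rw [qdMinus1, Matrix.of_apply, if_pos le_rfl, Ring.inverse_mul_cancel_right _ _ hH]

theorem qdPlus2_apply_self (i : Fin n) :
    qdPlus2 Lm1 Lp2 u1 u2 i i =
      minorQD (Lm1 * Lp2) i i i * descProd (qdFactorDesc (Lm1 * Lp2) u1 u2) i := by
  rw [qdPlus2, Matrix.of_apply, if_pos le_rfl]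

theorem qdMinus2_apply_self (h : IsLPair (Lp1 * Lp2) (Lm1 * Lm2) (u1 * u2)) (i : Fin n) :
    qdMinus2 Lm1 Lp2 Lm2 u1 u2 i i =
      u1 i.castSucc * u2 i.castSucc * descProd (qdFactorDesc (Lm1 * Lp2) u1 u2) i := by
  rw [qdMinus2, Matrix.of_apply, if_pos le_rfl, h.rowQD_self, Pi.mul_apply]

theorem exists_isLPair_qd1 (h : IsLPair (Lp1 * Lp2) (Lm1 * Lm2) (u1 * u2))
    (hH : ∀ k, IsUnit (minorQD (Lm1 * Lp2) k k k)) :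
    ∃ v, IsLPair (qdPlus1 Lp1 Lm1 Lp2 u1 u2) (qdMinus1 Lm1 Lp2 u1 u2) v := by
  refine exists_isLPair (fun i j hij => if_neg hij.not_ge) (fun i j hij => if_neg hij.not_ge) ?_ ?_
  · intro h0
    rw [qdMinus1_apply_self (hH _), ascProd_zero]
  · intro i hi
    rw [qdMinus1_apply_self (hH _), ascProd_succ, qdPlus1_apply_self h]

theorem exists_isLPair_qd2 (h : IsLPair (Lp1 * Lp2) (Lm1 * Lm2) (u1 * u2))
    (hu : ∀ k : Fin n, IsUnit (u1 k.castSucc * u2 k.castSucc)) :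
    ∃ v, IsLPair (qdPlus2 Lm1 Lp2 u1 u2) (qdMinus2 Lm1 Lp2 Lm2 u1 u2) v := by
  refine exists_isLPair (fun i j hij => if_neg hij.not_ge) (fun i j hij => if_neg hij.not_ge) ?_ ?_
  · intro h0
    rw [qdMinus2_apply_self h, descProd_zero, mul_one]
    exact h.u_zero
  · intro i hi
    rw [qdMinus2_apply_self h, descProd_succ, qdPlus2_apply_self, qdFactorDesc,
      mul_assoc (Ring.inverse _)]
    exact Ring.mul_inverse_cancel_left _ _ (hu ⟨i + 1, hi⟩)

end Gauge

section BlockMatrix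

variable {R : Type*} [Ring R] {n : ℕ} {Lp1 Lm1 Lp2 Lm2 : Matrix (Fin n) (Fin n) R}
  {u1 u2 : Fin (n + 1) → R}

theorem leftCoord_blockM_self (h : IsLPair (Lp1 * Lp2) (Lm1 * Lm2) (u1 * u2)) {k : Fin n}
    (hk : IsUnit ((Lm1 * Lp2).submatrix (tailIdx k) (tailIdx k)))
    (hH : IsUnit (minorQD (Lm1 * Lp2) k k k)) :
    leftCoord (blockM Lp1 Lm1 Lp2 Lm2) k (Sum.inl k) = qdFactorAsc (Lm1 * Lp2) u1 u2 k :=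
  (leftCoord_inl hk hH k).trans (congrArg _ (h.colQD_self (Lm1 * Lp2) k))

theorem qpPlus1_blockM (h : IsLPair (Lp1 * Lp2) (Lm1 * Lm2) (u1 * u2))
    (hJ : ∀ k, IsUnit ((Lm1 * Lp2).submatrix (tailIdx k) (tailIdx k)))
    (hH : ∀ k, IsUnit (minorQD (Lm1 * Lp2) k k k)) :
    qpPlus1 (blockM Lp1 Lm1 Lp2 Lm2) = qdPlus1 Lp1 Lm1 Lp2 u1 u2 := by
  ext i j
  have hcoord := leftCoord_inl (M := blockM Lp1 Lm1 Lp2 Lm2) (hJ i) (hH i) j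
  simp only [qpPlus1, qdPlus1, Matrix.of_apply, leftCoord_blockM_self h (hJ _) (hH _), hcoord,
    mul_assoc]
  rfl

theorem qpMinus1_blockM (h : IsLPair (Lp1 * Lp2) (Lm1 * Lm2) (u1 * u2))
    (hJ : ∀ k, IsUnit ((Lm1 * Lp2).submatrix (tailIdx k) (tailIdx k)))
    (hH : ∀ k, IsUnit (minorQD (Lm1 * Lp2) k k k)) :
    qpMinus1 (blockM Lp1 Lm1 Lp2 Lm2) = qdMinus1 Lm1 Lp2 u1 u2 := by
  ext j i
  have hcoord := leftCoord_inr (M := blockM Lp1 Lm1 Lp2 Lm2) (hJ j) (hH j) i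
  simp only [qpMinus1, qdMinus1, Matrix.of_apply, leftCoord_blockM_self h (hJ _) (hH _), hcoord,
    mul_assoc]
  rfl

theorem isUnit_rowQD_self (h : IsLPair (Lp1 * Lp2) (Lm1 * Lm2) (u1 * u2)) {k : Fin n}
    (hu : IsUnit (u1 k.castSucc * u2 k.castSucc)) :
    IsUnit (rowQD (Lm1 * Lm2) (Lm1 * Lp2) k k) := by
  rwa [h.rowQD_self]

theorem rightCoord_blockM_inl (h : IsLPair (Lp1 * Lp2) (Lm1 * Lm2) (u1 * u2)) {k : Fin n}
    (hu : IsUnit (u1 k.castSucc * u2 k.castSucc))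
    (hk : IsUnit ((Lm1 * Lp2).submatrix (tailIdx k) (tailIdx k))) (j : Fin n) :
    rightCoord (blockM Lp1 Lm1 Lp2 Lm2) k (Sum.inl j) =
      rowQD (Lm1 * Lm2) (Lm1 * Lp2) j k * Ring.inverse (u1 k.castSucc * u2 k.castSucc) :=
  (rightCoord_inl hk (isUnit_rowQD_self h hu) j).trans
    (congrArg (_ * Ring.inverse ·) (h.rowQD_self (Lm1 * Lp2) k))

theorem rightCoord_blockM_inr (h : IsLPair (Lp1 * Lp2) (Lm1 * Lm2) (u1 * u2)) {k : Fin n}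
    (hu : IsUnit (u1 k.castSucc * u2 k.castSucc))
    (hk : IsUnit ((Lm1 * Lp2).submatrix (tailIdx k) (tailIdx k))) (i : Fin n) :
    rightCoord (blockM Lp1 Lm1 Lp2 Lm2) k (Sum.inr i) =
      minorQD (Lm1 * Lp2) k i k * Ring.inverse (u1 k.castSucc * u2 k.castSucc) :=
  (rightCoord_inr hk (isUnit_rowQD_self h hu) i).trans
    (congrArg (_ * Ring.inverse ·) (h.rowQD_self (Lm1 * Lp2) k))

theorem inverse_mul_descProd_rightCoord (h : IsLPair (Lp1 * Lp2) (Lm1 * Lm2) (u1 * u2))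
    (hu : ∀ k : Fin n, IsUnit (u1 k.castSucc * u2 k.castSucc))
    (hJ : ∀ k, IsUnit ((Lm1 * Lp2).submatrix (tailIdx k) (tailIdx k))) (j : Fin n) :
    Ring.inverse (u1 j.castSucc * u2 j.castSucc) *
        descProd (fun k => rightCoord (blockM Lp1 Lm1 Lp2 Lm2) k (Sum.inr k)) j =
      descProd (qdFactorDesc (Lm1 * Lp2) u1 u2) j := by
  have hzero : u1 0 * u2 0 = 1 := h.u_zero
  simp only [rightCoord_blockM_inr h (hu _) (hJ _)]
  exact mul_descProd_castSucc (fun k => minorQD (Lm1 * Lp2) k k k)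
    (w := fun k => Ring.inverse (u1 k * u2 k)) (by rw [hzero, Ring.inverse_one]) j

theorem qpPlus2_blockM (h : IsLPair (Lp1 * Lp2) (Lm1 * Lm2) (u1 * u2))
    (hu : ∀ k : Fin n, IsUnit (u1 k.castSucc * u2 k.castSucc))
    (hJ : ∀ k, IsUnit ((Lm1 * Lp2).submatrix (tailIdx k) (tailIdx k))) :
    qpPlus2 (blockM Lp1 Lm1 Lp2 Lm2) = qdPlus2 Lm1 Lp2 u1 u2 := by
  ext i j
  rw [qpPlus2, qdPlus2, Matrix.of_apply, Matrix.of_apply, rightCoord_blockM_inr h (hu j) (hJ j),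
    mul_assoc, inverse_mul_descProd_rightCoord h hu hJ]

theorem qpMinus2_blockM (h : IsLPair (Lp1 * Lp2) (Lm1 * Lm2) (u1 * u2))
    (hu : ∀ k : Fin n, IsUnit (u1 k.castSucc * u2 k.castSucc))
    (hJ : ∀ k, IsUnit ((Lm1 * Lp2).submatrix (tailIdx k) (tailIdx k))) :
    qpMinus2 (blockM Lp1 Lm1 Lp2 Lm2) = qdMinus2 Lm1 Lp2 Lm2 u1 u2 := by
  ext j i
  rw [qpMinus2, qdMinus2, Matrix.of_apply, Matrix.of_apply, rightCoord_blockM_inl h (hu i) (hJ i),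
    mul_assoc, inverse_mul_descProd_rightCoord h hu hJ]

end BlockMatrix

theorem theorem2p5_general {R : Type*} [Ring R] {n : ℕ}
    (Lp1 Lm1 Lp2 Lm2 : Matrix (Fin n) (Fin n) R) (u1 u2 : Fin (n + 1) → R)
    (h : IsLPair (Lp1 * Lp2) (Lm1 * Lm2) (u1 * u2))
    (hu : ∀ k : Fin n, IsUnit (u1 k.castSucc * u2 k.castSucc))
    (hJ : ∀ k : Fin n,
      QuasiDetDefined ((Lm1 * Lp2).submatrix (consTail k k) (consTail k k)) 0 0 ∧
        IsUnit (minorQD (Lm1 * Lp2) k k k)) :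
    let M := blockM Lp1 Lm1 Lp2 Lm2
    (∀ k : Fin n,
      LeftQPDefined (lowerRows M k) (fun l => Sum.inr (tailIdx k l)) (Sum.inr k) ∧
        RightQPDefined (rightCols M k) (fun l => Sum.inr (tailIdx k l)) (Sum.inl k)) ∧
    (qpPlus1 M = qdPlus1 Lp1 Lm1 Lp2 u1 u2 ∧ qpMinus1 M = qdMinus1 Lm1 Lp2 u1 u2 ∧
      qpPlus2 M = qdPlus2 Lm1 Lp2 u1 u2 ∧ qpMinus2 M = qdMinus2 Lm1 Lp2 Lm2 u1 u2) ∧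
    (∃ v1 v2 : Fin (n + 1) → R,
      IsLPair (qpPlus1 M) (qpMinus1 M) v1 ∧ IsLPair (qpPlus2 M) (qpMinus2 M) v2) ∧
    ZeroCurvature Lp1 Lm1 Lp2 Lm2 (qpPlus1 M) (qpMinus1 M) (qpPlus2 M) (qpMinus2 M) := by
  intro M
  have htail k : IsUnit ((Lm1 * Lp2).submatrix (tailIdx k) (tailIdx k)) := (hJ k).1
  have hH k : IsUnit (minorQD (Lm1 * Lp2) k k k) := (hJ k).2
  have hp1 : qpPlus1 M = _ := qpPlus1_blockM h htail hH
  have hm1 : qpMinus1 M = _ := qpMinus1_blockM h htail hH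
  have hp2 : qpPlus2 M = _ := qpPlus2_blockM h hu htail
  have hm2 : qpMinus2 M = _ := qpMinus2_blockM h hu htail
  refine ⟨fun k => ⟨leftQPDefined_lowerRows (htail k) (hH k),
    rightQPDefined_rightCols (htail k) (isUnit_rowQD_self h (hu k))⟩, ⟨hp1, hm1, hp2, hm2⟩, ?_⟩
  rw [hp1, hm1, hp2, hm2]
  obtain ⟨v1, hv1⟩ := exists_isLPair_qd1 h hH
  obtain ⟨v2, hv2⟩ := exists_isLPair_qd2 h hu
  exact ⟨⟨v1, v2, hv1, hv2⟩, zeroCurvature_qd h hu htail hH⟩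

theorem theorem2p5 {R : Type*} [Ring R] {n : ℕ}
    (Lp1 Lm1 Lp2 Lm2 : Matrix (Fin n) (Fin n) R) (u1 u2 : Fin (n + 1) → R)
    (h1 : IsLPair Lp1 Lm1 u1) (h2 : IsLPair Lp2 Lm2 u2)
    -- `u_k^{(1)} u_k^{(2)}` is invertible for `0 ≤ k ≤ n - 1`
    (hu : ∀ k : Fin n, IsUnit (u1 k.castSucc * u2 k.castSucc))
    -- `|J^{k, …, n}_{k, …, n}|_{kk}` is well defined and invertible for `1 ≤ k ≤ n`
    (hJ : ∀ k : Fin n,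
      QuasiDetDefined ((Lm1 * Lp2).submatrix (consTail k k) (consTail k k)) 0 0 ∧
        IsUnit (minorQD (Lm1 * Lp2) k k k)) :
    let M := blockM Lp1 Lm1 Lp2 Lm2
    -- all quasi-Plücker coordinates that occur are well defined
    (∀ k : Fin n,
      LeftQPDefined (lowerRows M k) (fun l => Sum.inr (tailIdx k l)) (Sum.inr k) ∧
        RightQPDefined (rightCols M k) (fun l => Sum.inr (tailIdx k l)) (Sum.inl k)) ∧
    -- the expressions in quasi-Plücker coordinates agree with those in quasi-determinants
    (qpPlus1 M = qdPlus1 Lp1 Lm1 Lp2 u1 u2 ∧ qpMinus1 M = qdMinus1 Lm1 Lp2 u1 u2 ∧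
      qpPlus2 M = qdPlus2 Lm1 Lp2 u1 u2 ∧ qpMinus2 M = qdMinus2 Lm1 Lp2 Lm2 u1 u2) ∧
    -- they satisfy the conditions on the matrix entries and solve the zero-curvature relation
    (∃ v1 v2 : Fin (n + 1) → R,
      IsLPair (qpPlus1 M) (qpMinus1 M) v1 ∧ IsLPair (qpPlus2 M) (qpMinus2 M) v2) ∧
    ZeroCurvature Lp1 Lm1 Lp2 Lm2 (qpPlus1 M) (qpMinus1 M) (qpPlus2 M) (qpMinus2 M) := by
  exact theorem2p5_general Lp1 Lm1 Lp2 Lm2 u1 u2 (h1.mul h2) hu hJ
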